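/- All rings are commutative with $1$. A *real closed ring* is a reduced ring $A$ such that (a) the squares of $A$ are the non-negative elements of a partial order $\le$ on $A$ making $(A,\le)$ an $f$-ring, i.e. a partially ordered ring in which $a\vee b$ and $a\wedge b$ exist and $c(a\wedge b)=ca\wedge cb$ for all $a,b\in A$ and $c\ge 0$; (b) if $0\le a\le b$ then $bc=a^2$ for some $c\in A$; (c) for every prime ideal $\mathfrak p$ the domain $A/\mathfrak p$ is integrally closed and its fraction field is real closed. The *rank* $\operatorname{rk}(A)$ of a ring $A$ is the supremum, over the prime ideals $\mathfrak p$ of $A$, of the number of minimal prime ideals contained in $\mathfrak p$. A prime ideal $\mathfrak q$ is a *branching ideal* if $\mathfrak q=\mathfrak q_1+\mathfrak q_2$ for two distinct prime ideals $\mathfrak q_1,\mathfrak q_2\subsetneq\mathfrak q$. An element $a$ of a ring is a *zero divisor* if $ab=0$ for some $b\neq 0$ (so $0$ is a zero divisor in a nonzero ring). **Proposition.** Let $n\ge 2$ and let $A$ be a local real closed ring of rank $n$, with maximal ideal $\mathfrak m_A$. The following are equivalent: 1. $\mathfrak m_A$ is a branching ideal. 2. For every prime ideal $\mathfrak q_1\neq\mathfrak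 m_A$ of $A$ there is a prime ideal $\mathfrak q_2\neq\mathfrak q_1$ of $A$ such that $\mathfrak q_1,\mathfrak q_2\subsetneq\mathfrak m_A$ and $\mathfrak m_A=\mathfrak q_1+\mathfrak q_2$. 3. There are distinct minimal prime ideals $\mathfrak p_1,\mathfrak p_2$ of $A$ with $\mathfrak m_A=\mathfrak p_1+\mathfrak p_2$. 4. For every minimal prime ideal $\mathfrak p_1$ of $A$ there is a minimal prime ideal $\mathfrak p_2\neq\mathfrak p_1$ of $A$ with $\mathfrak m_A=\mathfrak p_1+\mathfrak p_2$. 5. Every non-unit of $A$ is a sum of two zero divisors. 6. The set of minimal prime ideals of $A$ has a partition into two non-empty sets $S_1,S_2$ with $\bigl(\bigcap_{\mathfrak p\in S_1}\mathfrak p\bigr)+\bigl(\bigcap_{\mathfrak p\in S_2}\mathfrak p\bigr)=\mathfrak m_A$. 7. There are $r,s\in\{1,\dots,n\}$ with $r+s=n$, a field $K$, local real closed rings $A_1,A_2$ with $\operatorname{rk}(A_1)=r$ and $\operatorname{rk}(A_2)=s$, and isomorphisms $A_1/\mathfrak m_{A_1}\cong K\cong A_2/\mathfrak m_{A_2}$,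 such that $A\cong A_1\times_K A_2$, the fibre product being taken along the resulting surjections $A_i\to A_i/\mathfrak m_{A_i}\cong K$. -/

import Mathlib

universe u

namespace BranchingIdeals

/-- A real closed ring (in the sense of Schwartz): a reduced commutative ring whose squares are the
non-negative elements of a partial order making it an `f`-ring (a lattice-ordered ring in which
multiplication by non-negative elements commutes with binary infima), such that `b` divides `a ^ 2`
whenever `0 ≤ a ≤ b`, and such that every residue domain is integrally closed with real closed
fraction field. -/
structure IsRealClosedRing (A : Type u) [CommRing A] : Prop where
  reduced : IsReduced A
  exists_order : ∃ _ : Lattice A, IsOrderedRing A ∧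
    (∀ a : A, 0 ≤ a ↔ IsSquare a) ∧
    (∀ a b c : A, 0 ≤ c → c * (a ⊓ b) = (c * a) ⊓ (c * b)) ∧
    (∀ a b : A, 0 ≤ a → a ≤ b → ∃ c : A, b * c = a ^ 2)
  isRealClosed_fractionRing : ∀ (P : Ideal A) [P.IsPrime], IsRealClosed (FractionRing (A ⧸ P))
  isIntegrallyClosed : ∀ (P : Ideal A) [P.IsPrime], IsIntegrallyClosed (A ⧸ P)

/-- The rank of an ideal `P`: the number of minimal primes of the ring contained in `P`. -/
noncomputable def idealRank {A : Type u} [CommRing A] (P : Ideal A) : ℕ∞ :=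
  {Q : Ideal A | Q ∈ minimalPrimes A ∧ Q ≤ P}.encard

/-- The rank of a ring: the supremum of the ranks of its prime ideals. -/
noncomputable def ringRank (A : Type u) [CommRing A] : ℕ∞ :=
  ⨆ P : PrimeSpectrum A, idealRank P.asIdeal

/-- A prime ideal `Q` is a branching ideal if it is the sum of two distinct prime ideals which are
properly contained in it. -/
def IsBranching {A : Type u} [CommRing A] (Q : Ideal A) : Prop :=
  Q.IsPrime ∧ ∃ Q₁ Q₂ : Ideal A, Q₁.IsPrime ∧ Q₂.IsPrime ∧ Q₁ ≠ Q₂ ∧ Q₁ < Q ∧ Q₂ < Q ∧ Q = Q₁ ⊔ Q₂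

/-- Zero divisors (zero is one of them in a nontrivial ring). -/
def IsZeroDivisor {A : Type u} [CommRing A] (a : A) : Prop :=
  ∃ b : A, b ≠ 0 ∧ a * b = 0

/-- The fibre product `A ×_C B` along `f` and `g`, as a subring of `A × B`. -/
def fibreProduct {A B C : Type u} [CommRing A] [CommRing B] [CommRing C]
    (f : A →+* C) (g : B →+* C) : Subring (A × B) :=
  (f.comp (RingHom.fst A B)).eqLocus (g.comp (RingHom.snd A B))

end BranchingIdeals

namespace BranchingIdeals

/-! In a real closed ring radical ideals are convex: if `0 ≤ a ≤ b` and `b ∈ I`, then `b * c = a ^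
2` puts `a` in `I`. Together with Riesz decomposition and `a⁺ * a⁻ = 0` this yields three facts:
sums of radical ideals are radical, the primes above a given prime form a chain, and a proper sum of
two primes is prime.

In the local case these give the exchange principle `IsRealClosedRing.sup_eq_or_sup_eq`: if `𝔪 = P₁
+ P₂` and `P` is prime, then `P + P₁` and `P + P₂` are comparable primes above `P`, so the larger
contains `P₁ + P₂` and equals `𝔪`. Statements 1 to 4 follow from one another by exchange. Moreover
`P + Q ≠ 𝔪` becomes an equivalence relation on minimal primes, and separating one class from the
others gives the partition in 6; the intersections sum to `𝔪` because their sum is radical and every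
prime above it contains some `P + Q = 𝔪`.

A partition presents `A` as the fibre product of the two quotients over the residue field; they are
real closed because reduced quotients inherit every axiom (`IsRealClosedRing.of_surjective`). In
such a fibre product a non-unit splits as `(x, 0) + (0, y)`, a sum of zero divisors. Conversely,
zero divisors of a reduced ring lie in minimal primes, so under 5 the finitely many primes `P + Q`
cover `𝔪`, and prime avoidance gives 3. -/

/-- The order-theoretic part of the definition of a real closed ring. -/
class IsRealClosedOrder (A : Type u) [CommRing A] [Lattice A] [IsOrderedRing A] : Prop where
  reduced : IsReduced A
  nonneg_iff_isSquare (a : A) : 0 ≤ a ↔ IsSquare a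
  mul_inf (a b c : A) : 0 ≤ c → c * (a ⊓ b) = (c * a) ⊓ (c * b)
  exists_mul_eq_sq (a b : A) : 0 ≤ a → a ≤ b → ∃ c : A, b * c = a ^ 2

/-! ### Convexity of radical ideals, and sums of radical and prime ideals. -/

section Order

variable {A : Type u} [CommRing A] [Lattice A] [IsOrderedRing A]

theorem exists_add_of_le_add {x p q : A} (hx : 0 ≤ x) (hp : 0 ≤ p) (hq : 0 ≤ q)
    (h : x ≤ p + q) : ∃ y z, 0 ≤ y ∧ y ≤ p ∧ 0 ≤ z ∧ z ≤ q ∧ x = y + z := by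
  refine ⟨x ⊓ p, x - x ⊓ p, le_inf hx hp, inf_le_right, sub_nonneg.2 inf_le_left, ?_, by ring⟩
  have h1 : x - q ≤ x ⊓ p := le_inf (sub_le_self _ hq) (sub_le_iff_le_add.2 h)
  exact sub_le_comm.1 h1

variable [IsRealClosedOrder A]

theorem sq_nonneg_of_isRealClosedOrder (a : A) : 0 ≤ a ^ 2 :=
  (IsRealClosedOrder.nonneg_iff_isSquare _).2 (IsSquare.sq a)

/-- With `u = a⁺` and `v = a⁻`, multiplying `u ⊓ v = 0` by `u` and by `v` gives `u² ⊓ uv = 0` and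
`uv ⊓ v² = 0`. From `uv ≤ u² + v²` the first yields `uv ≤ v²`, and then the second yields `uv ≤ 0`.
-/
theorem posPart_mul_negPart_eq_zero (a : A) : a⁺ * a⁻ = 0 := by
  have hu := posPart_nonneg a
  have hv := negPart_nonneg a
  have huv : a⁺ ⊓ a⁻ = 0 := posPart_inf_negPart_eq_zero a
  have h1 := IsRealClosedOrder.mul_inf a⁺ a⁻ a⁺ hu
  have h2 := IsRealClosedOrder.mul_inf a⁺ a⁻ a⁻ hv
  rw [huv, mul_zero] at h1 h2
  set u := a⁺
  set v := a⁻
  have h0 : 0 ≤ u * v := mul_nonneg hu hv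
  have h3 : u * v ≤ u ^ 2 + v ^ 2 := by
    have h4 := add_nonneg (sq_nonneg_of_isRealClosedOrder (u - v)) h0
    rw [← sub_nonneg]
    convert h4 using 1
    ring
  have h4 : u * v - v ^ 2 ≤ 0 := by
    rw [h1]
    refine le_inf ?_ (sub_le_self _ (sq_nonneg_of_isRealClosedOrder v))
    rw [sub_le_iff_le_add, ← sq]
    exact h3
  refine le_antisymm ?_ h0
  rw [h2]
  refine le_inf (le_of_eq (mul_comm _ _)) ?_
  rw [← sq]
  exact sub_nonpos.1 h4

theorem abs_sq_eq_sq (a : A) : |a| ^ 2 = a ^ 2 := by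
  have h1 : a⁺ + a⁻ = |a| := posPart_add_negPart a
  have h2 : a⁺ - a⁻ = a := posPart_sub_negPart a
  rw [← h1]
  nth_rw 3 [← h2]
  linear_combination 4 * posPart_mul_negPart_eq_zero a

theorem abs_mem_of_isRadical {I : Ideal A} (hI : I.IsRadical) {a : A} (ha : a ∈ I) : |a| ∈ I :=
  hI ⟨2, by rw [abs_sq_eq_sq]; exact I.pow_mem_of_mem ha 2 two_pos⟩

theorem mem_of_nonneg_of_le {I : Ideal A} (hI : I.IsRadical) {a b : A} (ha : 0 ≤ a) (hab : a ≤ b)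
    (hb : b ∈ I) : a ∈ I := by
  obtain ⟨c, hc⟩ := IsRealClosedOrder.exists_mul_eq_sq a b ha hab
  exact hI ⟨2, hc ▸ I.mul_mem_right c hb⟩

/-- Put `d = (a - b)⁺`. Since `d * (a - b) = d²` and `d ≤ a + b`, one gets `d³ ≤ d² (a + b) = d (a²
- b²) ≤ 0`, and reducedness forces `d = 0`. -/
theorem le_of_sq_le_sq_of_nonneg {a b : A} (ha : 0 ≤ a) (hb : 0 ≤ b) (h : a ^ 2 ≤ b ^ 2) :
    a ≤ b := by
  have := IsRealClosedOrder.reduced (A := A)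
  have hd0 : 0 ≤ (a - b)⁺ := posPart_nonneg _
  have hmul := posPart_mul_negPart_eq_zero (a - b)
  have hsub : (a - b)⁺ - (a - b)⁻ = a - b := posPart_sub_negPart (a - b)
  have hda : (a - b)⁺ ≤ a + b := sup_le ((sub_le_self _ hb).trans (le_add_of_nonneg_right hb))
    (add_nonneg ha hb)
  set d := (a - b)⁺
  set e := (a - b)⁻
  have h1 : d ^ 2 * (a + b) ≤ 0 := by
    have h2 : 0 ≤ d * (b ^ 2 - a ^ 2) := mul_nonneg hd0 (sub_nonneg.2 h)
    rw [← neg_nonneg]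
    convert h2 using 1
    linear_combination (-(a + b) * d) * hsub - (a + b) * hmul
  have h3 : d ^ 3 ≤ 0 := by
    refine le_trans ?_ h1
    rw [pow_succ]
    exact mul_le_mul_of_nonneg_left hda (pow_nonneg hd0 2)
  have h4 : d ^ 3 = 0 := le_antisymm h3 (pow_nonneg hd0 3)
  have h5 : d = 0 := pow_eq_zero_iff (three_ne_zero) |>.1 h4
  have h6 : a - b ≤ d := le_posPart _
  rw [h5] at h6
  exact sub_nonpos.1 h6

theorem mem_sup_of_nonneg_of_le {I J : Ideal A} (hI : I.IsRadical) (hJ : J.IsRadical) {x i j : A}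
    (hx : 0 ≤ x) (hi : i ∈ I) (hj : j ∈ J) (h : x ≤ |i| + |j|) :
    ∃ y ∈ I, ∃ z ∈ J, 0 ≤ y ∧ 0 ≤ z ∧ x = y + z := by
  obtain ⟨y, z, hy, hyi, hz, hzj, hxyz⟩ := exists_add_of_le_add hx (abs_nonneg i) (abs_nonneg j) h
  exact ⟨y, mem_of_nonneg_of_le hI hy hyi (abs_mem_of_isRadical hI hi), z,
    mem_of_nonneg_of_le hJ hz hzj (abs_mem_of_isRadical hJ hj), hy, hz, hxyz⟩

/-- If `a² ∈ I + J`, Riesz decomposition writes `a² = s² + t²` with `s ∈ I` and `t ∈ J`. Then `|a| ≤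
|s| + |t|`, so `a⁺` and `a⁻` decompose in turn. -/
theorem isRadical_sup_of_order {I J : Ideal A} (hI : I.IsRadical) (hJ : J.IsRadical) :
    (I ⊔ J).IsRadical := by
  rw [Ideal.isRadical_iff_pow_one_lt 2 one_lt_two]
  intro a ha
  obtain ⟨i, hi, j, hj, hij⟩ := Submodule.mem_sup.1 ha
  obtain ⟨y, hy, z, hz, hy0, hz0, hyz⟩ := mem_sup_of_nonneg_of_le hI hJ
    (sq_nonneg_of_isRealClosedOrder a) hi hj (hij ▸ add_le_add (le_abs_self i) (le_abs_self j))
  obtain ⟨s, rfl⟩ := (IsRealClosedOrder.nonneg_iff_isSquare y).1 hy0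
  obtain ⟨t, rfl⟩ := (IsRealClosedOrder.nonneg_iff_isSquare z).1 hz0
  have hs : s ∈ I := hI ⟨2, by rwa [sq]⟩
  have ht : t ∈ J := hJ ⟨2, by rwa [sq]⟩
  have habs : |a| ≤ |s| + |t| := by
    refine le_of_sq_le_sq_of_nonneg (abs_nonneg a) (add_nonneg (abs_nonneg s) (abs_nonneg t)) ?_
    rw [abs_sq_eq_sq, hyz, ← sq, ← sq, ← abs_sq_eq_sq s, ← abs_sq_eq_sq t, ← sub_nonneg]
    have := mul_nonneg (abs_nonneg s) (abs_nonneg t)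
    convert add_nonneg this this using 1
    ring
  have key (x : A) (hx0 : 0 ≤ x) (hxa : x ≤ |a|) : x ∈ I ⊔ J := by
    obtain ⟨y, hy, z, hz, -, -, hyz⟩ := mem_sup_of_nonneg_of_le hI hJ hx0 hs ht (hxa.trans habs)
    exact Submodule.mem_sup.2 ⟨y, hy, z, hz, hyz.symm⟩
  rw [← posPart_sub_negPart a]
  refine (I ⊔ J).sub_mem (key _ (posPart_nonneg a) ?_) (key _ (negPart_nonneg a) ?_)
  · exact sup_le (le_abs_self a) (abs_nonneg a)
  · exact sup_le (neg_le_abs a) (abs_nonneg a)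

/-- For `x ∈ Q \ R` and `y ∈ R \ Q`, the prime `P` contains one of `(x² - y²)⁺`, `(x² - y²)⁻`.
Modulo `P` one square is then bounded by the other, and convexity of `R` or `Q` gives a
contradiction. -/
theorem le_or_le_of_prime_le_of_order {P Q R : Ideal A} [hP : P.IsPrime] [hQ : Q.IsPrime]
    [hR : R.IsPrime] (hPQ : P ≤ Q) (hPR : P ≤ R) : Q ≤ R ∨ R ≤ Q := by
  by_contra! h
  obtain ⟨x, hxQ, hxR⟩ := SetLike.not_le_iff_exists.1 h.1
  obtain ⟨y, hyR, hyQ⟩ := SetLike.not_le_iff_exists.1 h.2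
  have key (K : Ideal A) (hK : K.IsPrime) (hPK : P ≤ K) (s t : A) (hs : s ∉ K) (ht : t ∈ K)
      (hst : (s ^ 2 - t ^ 2)⁺ ∈ P) : False := by
    refine hs (hK.mem_of_pow_mem 2 (mem_of_nonneg_of_le hK.isRadical
      (sq_nonneg_of_isRealClosedOrder s) (b := t ^ 2 + (s ^ 2 - t ^ 2)⁺) ?_
      (K.add_mem (K.pow_mem_of_mem ht 2 two_pos) (hPK hst))))
    rw [← sub_le_iff_le_add']
    exact le_posPart _
  have h0 : (x ^ 2 - y ^ 2)⁺ * (x ^ 2 - y ^ 2)⁻ ∈ P := by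
    rw [posPart_mul_negPart_eq_zero]
    exact P.zero_mem
  rcases hP.mem_or_mem h0 with h1 | h1
  · exact key R hR hPR x y hxR hyR h1
  · refine key Q hQ hPQ y x hyQ hxQ ?_
    rwa [← neg_sub, posPart_neg]

theorem isPrime_sup_of_order {P Q : Ideal A} [hP : P.IsPrime] [hQ : Q.IsPrime]
    (h : P ⊔ Q ≠ ⊤) : (P ⊔ Q).IsPrime := by
  have hrad := isRadical_sup_of_order hP.isRadical hQ.isRadical
  -- Modulo `P` one has `s² ≤ t²`, hence `s⁴ ≤ (s * t)²`; convexity of the radical ideal `P ⊔ Q`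
  -- applies.
  have key (s t : A) (hst : s * t ∈ P ⊔ Q) (hp : (s ^ 2 - t ^ 2)⁺ ∈ P) : s ∈ P ⊔ Q := by
    refine hrad ⟨4, mem_of_nonneg_of_le hrad (b := (s * t) ^ 2 + s ^ 2 * (s ^ 2 - t ^ 2)⁺)
      ?_ ?_ ?_⟩
    · convert sq_nonneg_of_isRealClosedOrder (s ^ 2) using 1
      ring
    · have := mul_le_mul_of_nonneg_left (le_posPart (s ^ 2 - t ^ 2))
        (sq_nonneg_of_isRealClosedOrder s)
      rw [← sub_le_iff_le_add']
      convert this using 1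
      ring
    · exact (P ⊔ Q).add_mem ((P ⊔ Q).pow_mem_of_mem hst 2 two_pos)
        ((P ⊔ Q).mul_mem_left _ (Ideal.mem_sup_left hp))
  refine ⟨h, fun {x y} hxy => ?_⟩
  have h0 : (x ^ 2 - y ^ 2)⁺ * (x ^ 2 - y ^ 2)⁻ ∈ P := by
    rw [posPart_mul_negPart_eq_zero]
    exact P.zero_mem
  rcases hP.mem_or_mem h0 with h1 | h1
  · exact .inl (key x y hxy h1)
  · refine .inr (key y x (mul_comm x y ▸ hxy) ?_)
    rwa [← neg_sub, posPart_neg]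

end Order

end BranchingIdeals

namespace BranchingIdeals

/-! ### Reduced quotients of real closed rings. -/

section Surjective

variable {A B : Type u} [CommRing A] [CommRing B] {f : A →+* B}

section Order

variable [Lattice A] [IsOrderedRing A] [IsRealClosedOrder A]

theorem isSquare_map_of_nonneg (f : A →+* B) {a : A} (ha : 0 ≤ a) : IsSquare (f a) :=
  ((IsRealClosedOrder.nonneg_iff_isSquare a).1 ha).map f

theorem exists_nonneg_of_isSquare (hf : Function.Surjective f) {x : B} (hx : IsSquare x) :
    ∃ a, 0 ≤ a ∧ f a = x := by
  obtain ⟨y, rfl⟩ := hx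
  obtain ⟨a, rfl⟩ := hf y
  exact ⟨a * a, (IsRealClosedOrder.nonneg_iff_isSquare _).2 ⟨a, rfl⟩, map_mul f a a⟩

theorem isSquare_add_of_surjective (hf : Function.Surjective f) {x y : B} (hx : IsSquare x)
    (hy : IsSquare y) : IsSquare (x + y) := by
  obtain ⟨a, ha, rfl⟩ := exists_nonneg_of_isSquare hf hx
  obtain ⟨b, hb, rfl⟩ := exists_nonneg_of_isSquare hf hy
  rw [← map_add]
  exact isSquare_map_of_nonneg f (add_nonneg ha hb)

variable [IsReduced B]

theorem eq_zero_of_isSquare_of_isSquare_neg (hf : Function.Surjective f) {x : B}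
    (hx : IsSquare x) (hx' : IsSquare (-x)) : x = 0 := by
  obtain ⟨a, ha, rfl⟩ := exists_nonneg_of_isSquare hf hx
  obtain ⟨b, hb, hab⟩ := exists_nonneg_of_isSquare hf hx'
  have hker : (RingHom.ker f).IsRadical := (RingHom.ker_isRadical_iff_reduced_of_surjective hf).2 ‹_›
  refine mem_of_nonneg_of_le hker ha (le_add_of_nonneg_right hb) ?_
  rw [RingHom.mem_ker, map_add, hab, add_neg_cancel]

/-- Lifts an inequality from the quotient at the cost of a non-negative kernel element, which is
what the lattice axioms on `B` are checked with. -/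
theorem exists_le_add_of_isSquare_sub (hf : Function.Surjective f) {a b : A}
    (h : IsSquare (f b - f a)) : ∃ k, f k = 0 ∧ 0 ≤ k ∧ a ≤ b + k := by
  obtain ⟨c, hc, hcab⟩ := exists_nonneg_of_isSquare hf h
  have hker : (RingHom.ker f).IsRadical := (RingHom.ker_isRadical_iff_reduced_of_surjective hf).2 ‹_›
  refine ⟨|a + c - b|, abs_mem_of_isRadical hker ?_, abs_nonneg _, ?_⟩
  · rw [RingHom.mem_ker, map_sub, map_add, hcab]
    ring
  · rw [← sub_le_iff_le_add']
    refine le_trans ?_ (le_abs_self _)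
    rw [← sub_nonneg]
    convert hc using 1
    ring

/-- The lattice structure on a reduced quotient of a real closed ring: the non-negative elements
are the squares. -/
noncomputable abbrev quotientLattice (hf : Function.Surjective f) : Lattice B where
  le x y := IsSquare (y - x)
  le_refl x := by simp
  le_trans x y z hxy hyz := by simpa using isSquare_add_of_surjective hf hyz hxy
  le_antisymm x y hxy hyx := by
    rw [eq_comm, ← sub_eq_zero]
    exact eq_zero_of_isSquare_of_isSquare_neg hf hxy (by simpa using hyx)
  inf x y := f (Function.surjInv hf x ⊓ Function.surjInv hf y)
  sup x y := f (Function.surjInv hf x ⊔ Function.surjInv hf y)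
  inf_le_left x y := by
    have := isSquare_map_of_nonneg f (sub_nonneg.2
      (inf_le_left (a := Function.surjInv hf x) (b := Function.surjInv hf y)))
    rwa [map_sub, Function.surjInv_eq hf] at this
  inf_le_right x y := by
    have := isSquare_map_of_nonneg f (sub_nonneg.2
      (inf_le_right (a := Function.surjInv hf x) (b := Function.surjInv hf y)))
    rwa [map_sub, Function.surjInv_eq hf] at this
  le_sup_left x y := by
    have := isSquare_map_of_nonneg f (sub_nonneg.2
      (le_sup_left (a := Function.surjInv hf x) (b := Function.surjInv hf y)))
    rwa [map_sub, Function.surjInv_eq hf] at this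
  le_sup_right x y := by
    have := isSquare_map_of_nonneg f (sub_nonneg.2
      (le_sup_right (a := Function.surjInv hf x) (b := Function.surjInv hf y)))
    rwa [map_sub, Function.surjInv_eq hf] at this
  le_inf x y z hxy hxz := by
    rw [← Function.surjInv_eq hf x, ← Function.surjInv_eq hf y] at hxy
    rw [← Function.surjInv_eq hf x, ← Function.surjInv_eq hf z] at hxz
    obtain ⟨k, hk, hk0, hky⟩ := exists_le_add_of_isSquare_sub hf hxy
    obtain ⟨l, hl, hl0, hlz⟩ := exists_le_add_of_isSquare_sub hf hxz
    have h : Function.surjInv hf x - (k + l) ≤ Function.surjInv hf y ⊓ Function.surjInv hf z := by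
      refine le_inf ?_ ?_
      · rw [sub_le_iff_le_add, ← add_assoc]
        exact hky.trans (le_add_of_nonneg_right hl0)
      · rw [sub_le_iff_le_add, add_comm k l, ← add_assoc]
        exact hlz.trans (le_add_of_nonneg_right hk0)
    have := isSquare_map_of_nonneg f (sub_nonneg.2 h)
    simpa [hk, hl, Function.surjInv_eq] using this
  sup_le x y z hxz hyz := by
    rw [← Function.surjInv_eq hf x, ← Function.surjInv_eq hf z] at hxz
    rw [← Function.surjInv_eq hf y, ← Function.surjInv_eq hf z] at hyz
    obtain ⟨k, hk, hk0, hkx⟩ := exists_le_add_of_isSquare_sub hf hxz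
    obtain ⟨l, hl, hl0, hly⟩ := exists_le_add_of_isSquare_sub hf hyz
    have h : Function.surjInv hf x ⊔ Function.surjInv hf y ≤ Function.surjInv hf z + (k + l) := by
      refine sup_le ?_ ?_
      · rw [← add_assoc]
        exact hkx.trans (le_add_of_nonneg_right hl0)
      · rw [add_comm k l, ← add_assoc]
        exact hly.trans (le_add_of_nonneg_right hk0)
    have := isSquare_map_of_nonneg f (sub_nonneg.2 h)
    simpa [hk, hl, Function.surjInv_eq] using this

/-- The meet on `B` was defined through chosen preimages; independence of that choice is needed to
transfer `mul_inf`. -/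
theorem quotientLattice_inf (hf : Function.Surjective f) (a b : A) :
    letI := quotientLattice hf
    f a ⊓ f b = f (a ⊓ b) := by
  let := quotientLattice hf
  have hmono {a b : A} (h : a ≤ b) : f a ≤ f b := by
    change IsSquare (f b - f a)
    rw [← map_sub]
    exact isSquare_map_of_nonneg f (sub_nonneg.2 h)
  refine le_antisymm ?_ (le_inf (hmono inf_le_left) (hmono inf_le_right))
  obtain ⟨c, hc⟩ := hf (f a ⊓ f b)
  have hca : f c ≤ f a := hc ▸ inf_le_left
  have hcb : f c ≤ f b := hc ▸ inf_le_right
  obtain ⟨k, hk, hk0, hka⟩ := exists_le_add_of_isSquare_sub hf hca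
  obtain ⟨l, hl, hl0, hlb⟩ := exists_le_add_of_isSquare_sub hf hcb
  have h : c - (k + l) ≤ a ⊓ b := by
    refine le_inf ?_ ?_
    · rw [sub_le_iff_le_add, ← add_assoc]
      exact hka.trans (le_add_of_nonneg_right hl0)
    · rw [sub_le_iff_le_add, add_comm k l, ← add_assoc]
      exact hlb.trans (le_add_of_nonneg_right hk0)
  have := hmono h
  rwa [map_sub, map_add, hk, hl, add_zero, sub_zero, hc] at this

theorem isOrderedRing_quotientLattice (hf : Function.Surjective f) :
    letI := quotientLattice hf
    IsOrderedRing B := by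
  let := quotientLattice hf
  have : IsOrderedAddMonoid B :=
    { add_le_add_left := fun x y h z => by
        change IsSquare (y + z - (x + z))
        rw [add_sub_add_right_eq_sub]
        exact h }
  have : ZeroLEOneClass B := ⟨by change IsSquare _; simp⟩
  refine IsOrderedRing.of_mul_nonneg fun x y hx hy => ?_
  change IsSquare (x - 0) at hx
  change IsSquare (y - 0) at hy
  change IsSquare (x * y - 0)
  rw [sub_zero] at *
  exact hx.mul hy

theorem isRealClosedOrder_quotientLattice (hf : Function.Surjective f) :
    letI := quotientLattice hf
    haveI := isOrderedRing_quotientLattice hf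
    IsRealClosedOrder B := by
  let := quotientLattice hf
  have := isOrderedRing_quotientLattice hf
  have hnn (x : B) : 0 ≤ x ↔ IsSquare x := by
    change IsSquare (x - 0) ↔ _
    rw [sub_zero]
  refine ⟨‹_›, hnn, fun x y z hz => ?_, fun x y hx hxy => ?_⟩
  · obtain ⟨a, rfl⟩ := hf x
    obtain ⟨b, rfl⟩ := hf y
    obtain ⟨c, hc, rfl⟩ := exists_nonneg_of_isSquare hf ((hnn z).1 hz)
    rw [quotientLattice_inf hf, ← map_mul, ← map_mul, ← map_mul, quotientLattice_inf hf,
      IsRealClosedOrder.mul_inf a b c hc]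
  · obtain ⟨a, ha, rfl⟩ := exists_nonneg_of_isSquare hf ((hnn x).1 hx)
    obtain ⟨b, hb, hab⟩ := exists_nonneg_of_isSquare hf hxy
    obtain ⟨c, hc⟩ := IsRealClosedOrder.exists_mul_eq_sq a (a + b) ha (le_add_of_nonneg_right hb)
    refine ⟨f c, ?_⟩
    rw [← map_pow, ← hc, map_mul, map_add, hab, add_sub_cancel]

end Order

theorem isSumSq_map {R S : Type*} [CommRing R] [CommRing S] (g : R →+* S) {x : R}
    (hx : IsSumSq x) : IsSumSq (g x) := by
  induction hx with
  | zero => rw [map_zero]; exact .zero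
  | sq_add a _ ih => rw [map_add, map_mul]; exact .sq_add _ ih

theorem isRealClosed_of_ringEquiv {K L : Type*} [Field K] [Field L] (e : K ≃+* L)
    [IsRealClosed K] : IsRealClosed L where
  one_add_ne_zero {s} hs h := by
    refine IsSemireal.one_add_ne_zero (R := K) (isSumSq_map (e.symm : L →+* K) hs) ?_
    simpa using congrArg e.symm h
  isSquare_or_isSquare_neg x := by
    rcases IsRealClosed.isSquare_or_isSquare_neg (e.symm x) with h | h
    · exact .inl (by simpa using h.map e)
    · exact .inr (by simpa using h.map e)
  exists_isRoot_of_odd_natDegree {p} hp := by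
    obtain ⟨x, hx⟩ := IsRealClosed.exists_isRoot_of_odd_natDegree
      (f := p.map (e.symm : L →+* K)) (by
        rwa [Polynomial.natDegree_map_eq_of_injective e.symm.injective])
    refine ⟨e x, ?_⟩
    have := hx.map (f := (e : K →+* L))
    simpa [Polynomial.map_map] using this

theorem IsRealClosedRing.exists_isRealClosedOrder (hA : IsRealClosedRing A) :
    ∃ (_ : Lattice A) (_ : IsOrderedRing A), IsRealClosedOrder A := by
  obtain ⟨L, hL, h1, h2, h3⟩ := hA.exists_order
  exact ⟨L, hL, hA.reduced, h1, h2, h3⟩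

/-- Every residue domain of `B` is a residue domain of `A`, so the conditions at primes carry over
by isomorphism. -/
theorem IsRealClosedRing.of_surjective [IsReduced B] (hA : IsRealClosedRing A)
    (hf : Function.Surjective f) : IsRealClosedRing B where
  reduced := ‹_›
  exists_order := by
    obtain ⟨_, _, _⟩ := hA.exists_isRealClosedOrder
    let := quotientLattice hf
    have := isOrderedRing_quotientLattice hf
    have h := isRealClosedOrder_quotientLattice hf
    exact ⟨_, this, h.2, h.3, h.4⟩
  isRealClosed_fractionRing P _ := by
    have hg : Function.Surjective ((Ideal.Quotient.mk P).comp f) :=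
      Ideal.Quotient.mk_surjective.comp hf
    have : (RingHom.ker ((Ideal.Quotient.mk P).comp f)).IsPrime := RingHom.ker_isPrime _
    have := hA.isRealClosed_fractionRing (RingHom.ker ((Ideal.Quotient.mk P).comp f))
    exact isRealClosed_of_ringEquiv
      (IsFractionRing.ringEquivOfRingEquiv
        (K := FractionRing (A ⧸ RingHom.ker ((Ideal.Quotient.mk P).comp f))) (RingHom.quotientKerEquivOfSurjective hg))
  isIntegrallyClosed P _ := by
    have hg : Function.Surjective ((Ideal.Quotient.mk P).comp f) :=
      Ideal.Quotient.mk_surjective.comp hf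
    have : (RingHom.ker ((Ideal.Quotient.mk P).comp f)).IsPrime := RingHom.ker_isPrime _
    have := hA.isIntegrallyClosed (RingHom.ker ((Ideal.Quotient.mk P).comp f))
    exact IsIntegrallyClosed.of_equiv (RingHom.quotientKerEquivOfSurjective hg)

end Surjective

end BranchingIdeals

namespace BranchingIdeals

/-! ### Minimal primes, rank and zero divisors. -/

section Rank

variable {A B : Type u} [CommRing A] [CommRing B]

theorem ringRank_eq_encard_minimalPrimes [IsLocalRing A] :
    ringRank A = (minimalPrimes A).encard := by
  refine le_antisymm (iSup_le fun P => Set.encard_le_encard fun Q hQ => hQ.1) ?_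
  refine le_trans (Set.encard_le_encard fun Q hQ => ?_)
    (le_iSup (fun P : PrimeSpectrum A => idealRank P.asIdeal)
      ⟨IsLocalRing.maximalIdeal A, inferInstance⟩)
  exact ⟨hQ, IsLocalRing.le_maximalIdeal (Ideal.IsMinimalPrime.isPrime hQ).ne_top⟩

theorem encard_minimalPrimes_of_surjective {f : A →+* B} (hf : Function.Surjective f) :
    (minimalPrimes B).encard = (RingHom.ker f).minimalPrimes.encard := by
  rw [RingHom.ker_eq_comap_bot, Ideal.comap_minimalPrimes_eq_of_surjective hf]
  exact (Set.InjOn.encard_image (Ideal.comap_injective_of_surjective f hf).injOn).symm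

theorem encard_minimalPrimes_of_ringEquiv (e : A ≃+* B) :
    (minimalPrimes B).encard = (minimalPrimes A).encard := by
  rw [encard_minimalPrimes_of_surjective (f := (e : A →+* B)) e.surjective,
    (RingHom.injective_iff_ker_eq_bot (e : A →+* B)).1 e.injective]

theorem exists_le_of_sInf_le {S : Set (Ideal A)} (hS : S.Finite) {P : Ideal A} [hP : P.IsPrime]
    (h : sInf S ≤ P) : ∃ Q ∈ S, Q ≤ P := by
  have h' : hS.toFinset.inf id ≤ P := by
    rwa [Finset.inf_id_eq_sInf, hS.coe_toFinset]
  obtain ⟨Q, hQ, hQP⟩ := hP.inf_le'.1 h'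
  exact ⟨Q, hS.mem_toFinset.1 hQ, hQP⟩

theorem isRadical_sInf {S : Set (Ideal A)} (hS : S ⊆ minimalPrimes A) : (sInf S).IsRadical := by
  rw [sInf_eq_iInf']
  exact Ideal.isRadical_iInf _ fun Q => (Ideal.IsMinimalPrime.isPrime (hS Q.2)).isRadical

theorem minimalPrimes_sInf {S : Set (Ideal A)} (hS : S.Finite) (hmin : S ⊆ minimalPrimes A) :
    (sInf S).minimalPrimes = S := by
  ext P
  constructor
  · intro hP
    have := Ideal.IsMinimalPrime.isPrime hP
    obtain ⟨Q, hQ, hQP⟩ := exists_le_of_sInf_le hS hP.1.2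
    have hPQ : P ≤ Q := hP.2 ⟨Ideal.IsMinimalPrime.isPrime (hmin hQ), sInf_le hQ⟩ hQP
    rwa [le_antisymm hPQ hQP]
  · intro hP
    refine ⟨⟨Ideal.IsMinimalPrime.isPrime (hmin hP), sInf_le hP⟩, fun Q hQ hQP => ?_⟩
    exact (hmin hP).2 ⟨hQ.1, bot_le⟩ hQP

theorem ringRank_quotient_sInf {S : Set (Ideal A)} (hS : S.Finite) (hmin : S ⊆ minimalPrimes A)
    [IsLocalRing (A ⧸ sInf S)] : ringRank (A ⧸ sInf S) = S.encard := by
  rw [ringRank_eq_encard_minimalPrimes,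
    encard_minimalPrimes_of_surjective (f := Ideal.Quotient.mk (sInf S))
      Ideal.Quotient.mk_surjective, Ideal.mk_ker, minimalPrimes_sInf hS hmin]

theorem IsZeroDivisor.exists_mem_minimalPrimes [IsReduced A] {a : A} (ha : IsZeroDivisor a) :
    ∃ P ∈ minimalPrimes A, a ∈ P := by
  obtain ⟨b, hb, hab⟩ := ha
  by_contra! h
  have hb' : b ∈ sInf (minimalPrimes A) := by
    refine Submodule.mem_sInf.2 fun P hP => ?_
    have hab' : a * b ∈ P := hab ▸ P.zero_mem
    exact ((Ideal.IsMinimalPrime.isPrime hP).mem_or_mem hab').resolve_left (h P hP)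
  rw [minimalPrimes, Ideal.sInf_minimalPrimes, Ideal.isRadical_bot.radical] at hb'
  exact hb hb'

end Rank

/-! ### Fibre products over a ring or a field. -/

section FibreProduct

variable {A B C : Type u} [CommRing A] [CommRing B] [CommRing C]

theorem mem_fibreProduct {f : A →+* C} {g : B →+* C} {x : A × B} :
    x ∈ fibreProduct f g ↔ f x.1 = g x.2 := Iff.rfl

/-- The canonical map from a ring onto the fibre product of two quotients over the quotient by the
sum of their kernels is an isomorphism if the kernels intersect trivially. -/
theorem nonempty_ringEquiv_fibreProduct {R : Type u} [CommRing R] {p : R →+* A} {q : R →+* B}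
    {f : A →+* C} {g : B →+* C} (hp : Function.Surjective p) (hq : Function.Surjective q)
    (hfg : f.comp p = g.comp q) (hinf : RingHom.ker p ⊓ RingHom.ker q = ⊥)
    (hsup : RingHom.ker (f.comp p) ≤ RingHom.ker p ⊔ RingHom.ker q) :
    Nonempty (R ≃+* fibreProduct f g) := by
  refine ⟨RingEquiv.ofBijective ((p.prod q).codRestrict (fibreProduct f g)
    fun x => RingHom.congr_fun hfg x) ⟨?_, ?_⟩⟩
  · rw [injective_iff_map_eq_zero]
    intro x hx
    have hx' : (p x, q x) = 0 := congrArg Subtype.val hx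
    have : x ∈ RingHom.ker p ⊓ RingHom.ker q := ⟨congrArg Prod.fst hx', congrArg Prod.snd hx'⟩
    rwa [hinf] at this
  · rintro ⟨⟨a, b⟩, hab⟩
    obtain ⟨x, rfl⟩ := hp a
    obtain ⟨y, rfl⟩ := hq b
    have hxy : x - y ∈ RingHom.ker (f.comp p) := by
      rw [RingHom.mem_ker, map_sub, sub_eq_zero]
      exact (mem_fibreProduct.1 hab).trans (RingHom.congr_fun hfg y).symm
    obtain ⟨i, hi, j, hj, hij⟩ := Submodule.mem_sup.1 (hsup hxy)
    refine ⟨x - i, Subtype.ext (Prod.ext ?_ ?_)⟩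
    · change p (x - i) = p x
      rw [map_sub, RingHom.mem_ker.1 hi, sub_zero]
    · change q (x - i) = q y
      rw [show x - i = y + j by linear_combination -hij, map_add, RingHom.mem_ker.1 hj, add_zero]

theorem nonempty_fibreProduct_ringEquiv_snd {f : A →+* C} {g : B →+* C}
    (hf : Function.Bijective f) : Nonempty (fibreProduct f g ≃+* B) := by
  refine ⟨RingEquiv.ofBijective ((RingHom.snd A B).comp (fibreProduct f g).subtype) ⟨?_, ?_⟩⟩
  · rintro ⟨⟨a, b⟩, hab⟩ ⟨⟨a', b'⟩, hab'⟩ h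
    obtain rfl : b = b' := h
    have : a = a' := hf.1 ((mem_fibreProduct.1 hab).trans (mem_fibreProduct.1 hab').symm)
    rw [Subtype.mk.injEq, this]
  · intro b
    obtain ⟨a, ha⟩ := hf.2 (g b)
    exact ⟨⟨(a, b), ha⟩, rfl⟩

theorem nonempty_fibreProduct_ringEquiv_fst {f : A →+* C} {g : B →+* C}
    (hg : Function.Bijective g) : Nonempty (fibreProduct f g ≃+* A) := by
  refine ⟨RingEquiv.ofBijective ((RingHom.fst A B).comp (fibreProduct f g).subtype) ⟨?_, ?_⟩⟩
  · rintro ⟨⟨a, b⟩, hab⟩ ⟨⟨a', b'⟩, hab'⟩ h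
    obtain rfl : a = a' := h
    have : b = b' := hg.1 ((mem_fibreProduct.1 hab).symm.trans (mem_fibreProduct.1 hab'))
    rw [Subtype.mk.injEq, this]
  · intro a
    obtain ⟨b, hb⟩ := hg.2 (f a)
    exact ⟨⟨(a, b), hb.symm⟩, rfl⟩

variable {K : Type u} [Field K]

theorem isUnit_fibreProduct {f : A →+* K} {g : B →+* K} (x : fibreProduct f g)
    (h₁ : IsUnit x.1.1) (h₂ : IsUnit x.1.2) : IsUnit x := by
  obtain ⟨a, ha⟩ := h₁.exists_right_inv
  obtain ⟨b, hb⟩ := h₂.exists_right_inv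
  have hx : f x.1.1 = g x.1.2 := x.2
  have hfa : f x.1.1 * f a = 1 := by rw [← map_mul, ha, map_one]
  have hgb : g x.1.2 * g b = 1 := by rw [← map_mul, hb, map_one]
  have hab : f a = g b := by
    rw [← hx] at hgb
    exact mul_left_cancel₀ (left_ne_zero_of_mul_eq_one hfa) (hfa.trans hgb.symm)
  exact IsUnit.of_mul_eq_one (⟨(a, b), hab⟩ : fibreProduct f g)
    (Subtype.ext (Prod.ext ha hb))

/-- If both structure maps of a fibre product have a nontrivial kernel, then its non-units are sums
of two zero divisors. -/
theorem exists_isZeroDivisor_add_fibreProduct {f : A →+* K} {g : B →+* K} [IsLocalHom f]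
    [IsLocalHom g] (hf : ¬ Function.Injective f) (hg : ¬ Function.Injective g)
    (x : fibreProduct f g) (hx : ¬ IsUnit x) :
    ∃ y z, IsZeroDivisor y ∧ IsZeroDivisor z ∧ x = y + z := by
  rw [injective_iff_map_eq_zero] at hf hg
  push Not at hf hg
  obtain ⟨a, ha, ha0⟩ := hf
  obtain ⟨b, hb, hb0⟩ := hg
  have hx2 : f x.1.1 = g x.1.2 := x.2
  have hx1 : f x.1.1 = 0 := by
    by_contra h
    refine hx (isUnit_fibreProduct x (isUnit_of_map_unit f _ (isUnit_iff_ne_zero.2 h))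
      (isUnit_of_map_unit g _ (isUnit_iff_ne_zero.2 (hx2 ▸ h))))
  have key₁ {s : A} (hs : f s = 0) : (s, 0) ∈ fibreProduct f g :=
    mem_fibreProduct.2 (by simpa using hs)
  have key₂ {t : B} (ht : g t = 0) : (0, t) ∈ fibreProduct f g :=
    mem_fibreProduct.2 (by simpa using ht.symm)
  -- The summands `(x₁, 0)` and `(0, x₂)` are killed by `(0, b)` and `(a, 0)`.
  refine ⟨⟨_, key₁ hx1⟩, ⟨_, key₂ (hx2 ▸ hx1)⟩, ⟨⟨_, key₂ hb⟩, ?_, ?_⟩, ⟨⟨_, key₁ ha⟩, ?_, ?_⟩, ?_⟩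
  · exact fun h => hb0 (congrArg (fun y => y.1.2) h)
  · exact Subtype.ext (Prod.ext (mul_zero _) (zero_mul _))
  · exact fun h => ha0 (congrArg (fun y => y.1.1) h)
  · exact Subtype.ext (Prod.ext (zero_mul _) (mul_zero _))
  · exact Subtype.ext (Prod.ext (add_zero _).symm (zero_add _).symm)

theorem IsZeroDivisor.map_ringEquiv (e : A ≃+* B) {a : A} (ha : IsZeroDivisor a) :
    IsZeroDivisor (e a) := by
  obtain ⟨b, hb, hab⟩ := ha
  exact ⟨e b, (map_ne_zero_iff e e.injective).2 hb, by rw [← map_mul, hab, map_zero]⟩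

end FibreProduct

end BranchingIdeals

namespace BranchingIdeals

/-! ### Local real closed rings and sums equal to the maximal ideal. -/

section Local

variable {A : Type u} [CommRing A]

theorem IsRealClosedRing.isRadical_sup (hA : IsRealClosedRing A) {I J : Ideal A}
    (hI : I.IsRadical) (hJ : J.IsRadical) : (I ⊔ J).IsRadical := by
  obtain ⟨_, _, _⟩ := hA.exists_isRealClosedOrder
  exact isRadical_sup_of_order hI hJ

theorem IsRealClosedRing.le_or_le (hA : IsRealClosedRing A) {P Q R : Ideal A} (hP : P.IsPrime)
    (hQ : Q.IsPrime) (hR : R.IsPrime) (hPQ : P ≤ Q) (hPR : P ≤ R) : Q ≤ R ∨ R ≤ Q := by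
  obtain ⟨_, _, _⟩ := hA.exists_isRealClosedOrder
  exact le_or_le_of_prime_le_of_order hPQ hPR

open IsLocalRing

theorem exists_isZeroDivisor_add_of_fibreProduct {n r s : ℕ} (hn : (minimalPrimes A).encard = n)
    (hr : 1 ≤ r) (hs : 1 ≤ s) (hrs : r + s = n) {A₁ A₂ K : Type u} [CommRing A₁] [CommRing A₂]
    [Field K] [IsLocalRing A₁] [IsLocalRing A₂] (e₁ : ResidueField A₁ ≃+* K)
    (e₂ : ResidueField A₂ ≃+* K) (hr₁ : ringRank A₁ = r) (hr₂ : ringRank A₂ = s)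
    (e : A ≃+* fibreProduct (e₁.toRingHom.comp (residue A₁)) (e₂.toRingHom.comp (residue A₂)))
    (a : A) (ha : ¬ IsUnit a) : ∃ b c, IsZeroDivisor b ∧ IsZeroDivisor c ∧ a = b + c := by
  have hsurj₁ : Function.Surjective (e₁.toRingHom.comp (residue A₁)) :=
    e₁.surjective.comp residue_surjective
  have hsurj₂ : Function.Surjective (e₂.toRingHom.comp (residue A₂)) :=
    e₂.surjective.comp residue_surjective
  have : IsLocalHom (e₁.toRingHom.comp (residue A₁)) := hsurj₁.isLocalHom
  have : IsLocalHom (e₂.toRingHom.comp (residue A₂)) := hsurj₂.isLocalHom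
  rw [ringRank_eq_encard_minimalPrimes] at hr₁ hr₂
  -- An injective structure map would be bijective, making `A` isomorphic to `A₂`, which has only `s
  -- < n` minimal primes.
  have hinj₁ : ¬ Function.Injective (e₁.toRingHom.comp (residue A₁)) := fun hinj => by
    obtain ⟨e'⟩ := nonempty_fibreProduct_ringEquiv_snd (g := e₂.toRingHom.comp (residue A₂))
      ⟨hinj, hsurj₁⟩
    have h := encard_minimalPrimes_of_ringEquiv (e.trans e')
    rw [hr₂, hn, Nat.cast_inj] at h
    omega
  have hinj₂ : ¬ Function.Injective (e₂.toRingHom.comp (residue A₂)) := fun hinj => by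
    obtain ⟨e'⟩ := nonempty_fibreProduct_ringEquiv_fst (f := e₁.toRingHom.comp (residue A₁))
      ⟨hinj, hsurj₂⟩
    have h := encard_minimalPrimes_of_ringEquiv (e.trans e')
    rw [hr₁, hn, Nat.cast_inj] at h
    omega
  obtain ⟨y, z, hy, hz, hyz⟩ := exists_isZeroDivisor_add_fibreProduct hinj₁ hinj₂ (e a)
    (by rwa [MulEquiv.isUnit_map])
  exact ⟨e.symm y, e.symm z, hy.map_ringEquiv e.symm, hz.map_ringEquiv e.symm,
    by rw [← map_add, ← hyz, e.symm_apply_apply]⟩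

variable [IsLocalRing A]

theorem IsRealClosedRing.isPrime_sup (hA : IsRealClosedRing A) {P Q : Ideal A} (hP : P.IsPrime)
    (hQ : Q.IsPrime) : (P ⊔ Q).IsPrime := by
  obtain ⟨_, _, _⟩ := hA.exists_isRealClosedOrder
  refine isPrime_sup_of_order fun h => (maximalIdeal.isMaximal A).ne_top (top_le_iff.1 ?_)
  rw [← h]
  exact sup_le (le_maximalIdeal hP.ne_top) (le_maximalIdeal hQ.ne_top)

/-- If the maximal ideal is the sum of two primes, then one of them is complementary to any given
prime. -/
theorem IsRealClosedRing.sup_eq_or_sup_eq (hA : IsRealClosedRing A) {P P₁ P₂ : Ideal A}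
    (hP : P.IsPrime) (h₁ : P₁.IsPrime) (h₂ : P₂.IsPrime) (h : maximalIdeal A = P₁ ⊔ P₂) :
    maximalIdeal A = P ⊔ P₁ ∨ maximalIdeal A = P ⊔ P₂ := by
  have hp₁ := hA.isPrime_sup hP h₁
  have hp₂ := hA.isPrime_sup hP h₂
  rcases hA.le_or_le hP hp₁ hp₂ le_sup_left le_sup_left with hle | hle
  · exact .inr (le_antisymm (h ▸ sup_le (le_sup_right.trans hle) le_sup_right)
      (le_maximalIdeal hp₂.ne_top))
  · exact .inl (le_antisymm (h ▸ sup_le le_sup_right (le_sup_right.trans hle))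
      (le_maximalIdeal hp₁.ne_top))

theorem lt_maximalIdeal_of_mem_minimalPrimes (hrank : 2 ≤ (minimalPrimes A).encard) {P : Ideal A}
    (hP : P ∈ minimalPrimes A) : P < maximalIdeal A := by
  refine lt_of_le_of_ne (le_maximalIdeal (Ideal.IsMinimalPrime.isPrime hP).ne_top) ?_
  rintro rfl
  have hsub : minimalPrimes A ⊆ {maximalIdeal A} := fun Q hQ => le_antisymm
    (le_maximalIdeal (Ideal.IsMinimalPrime.isPrime hQ).ne_top)
    (hP.2 ⟨Ideal.IsMinimalPrime.isPrime hQ, bot_le⟩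
      (le_maximalIdeal (Ideal.IsMinimalPrime.isPrime hQ).ne_top))
  have h := hrank.trans (Set.encard_le_encard hsub)
  rw [Set.encard_singleton] at h
  exact absurd h (by decide)

/-- Exchange replaces `Q₁` by a minimal prime below it, then `Q₂` likewise; the other alternative
would make some `Qᵢ` maximal. -/
theorem IsRealClosedRing.exists_minimalPrimes_of_isBranching (hA : IsRealClosedRing A)
    (h : IsBranching (maximalIdeal A)) :
    ∃ P₁ ∈ minimalPrimes A, ∃ P₂ ∈ minimalPrimes A, P₁ ≠ P₂ ∧ maximalIdeal A = P₁ ⊔ P₂ := by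
  obtain ⟨-, Q₁, Q₂, hQ₁, hQ₂, -, hlt₁, hlt₂, hsum⟩ := h
  obtain ⟨P₁, hP₁, hPQ₁⟩ := Ideal.exists_minimalPrimes_le (bot_le : ⊥ ≤ Q₁)
  obtain ⟨P₂, hP₂, hPQ₂⟩ := Ideal.exists_minimalPrimes_le (bot_le : ⊥ ≤ Q₂)
  have hp₁ := Ideal.IsMinimalPrime.isPrime hP₁
  have hp₂ := Ideal.IsMinimalPrime.isPrime hP₂
  have hsup : maximalIdeal A = P₁ ⊔ P₂ := by
    rcases hA.sup_eq_or_sup_eq hp₁ hQ₁ hQ₂ hsum with h | h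
    · exact absurd (h.trans (sup_eq_right.2 hPQ₁)) hlt₁.ne'
    · rcases hA.sup_eq_or_sup_eq hp₂ hp₁ hQ₂ h with h' | h'
      · rw [h', sup_comm]
      · exact absurd (h'.trans (sup_eq_right.2 hPQ₂)) hlt₂.ne'
  refine ⟨P₁, hP₁, P₂, hP₂, ?_, hsup⟩
  rintro rfl
  rw [sup_idem] at hsup
  exact (hsup ▸ hPQ₁).not_gt hlt₁

theorem IsRealClosedRing.sInf_sup_sInf_eq_maximalIdeal (hA : IsRealClosedRing A)
    {S₁ S₂ : Set (Ideal A)} (hS₁ : S₁ ⊆ minimalPrimes A) (hS₂ : S₂ ⊆ minimalPrimes A)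
    (hfin₁ : S₁.Finite) (hfin₂ : S₂.Finite) (hne₁ : S₁.Nonempty) (hne₂ : S₂.Nonempty)
    (h : ∀ P ∈ S₁, ∀ Q ∈ S₂, maximalIdeal A = P ⊔ Q) :
    sInf S₁ ⊔ sInf S₂ = maximalIdeal A := by
  refine le_antisymm ?_ ?_
  · obtain ⟨P, hP⟩ := hne₁
    obtain ⟨Q, hQ⟩ := hne₂
    rw [h P hP Q hQ]
    exact sup_le_sup (sInf_le hP) (sInf_le hQ)
  · rw [← (hA.isRadical_sup (isRadical_sInf hS₁) (isRadical_sInf hS₂)).radical,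
      Ideal.radical_eq_sInf]
    refine le_sInf fun P ⟨hle, hP⟩ => ?_
    obtain ⟨Q₁, hQ₁, hle₁⟩ := exists_le_of_sInf_le hfin₁ (le_sup_left.trans hle)
    obtain ⟨Q₂, hQ₂, hle₂⟩ := exists_le_of_sInf_le hfin₂ (le_sup_right.trans hle)
    rw [h Q₁ hQ₁ Q₂ hQ₂]
    exact sup_le hle₁ hle₂

/-- `S₁` collects the `P` with `P + P₁ ≠ 𝔪`, and `S₂` the rest. For `P ∈ S₁` and `Q ∈ S₂`, exchange
in `𝔪 = Q + P₁` leaves only `P + Q = 𝔪`. -/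
theorem IsRealClosedRing.exists_partition (hA : IsRealClosedRing A)
    (hfin : (minimalPrimes A).Finite) (hrank : 2 ≤ (minimalPrimes A).encard) {P₁ P₂ : Ideal A}
    (h₁ : P₁ ∈ minimalPrimes A) (h₂ : P₂ ∈ minimalPrimes A) (hsum : maximalIdeal A = P₁ ⊔ P₂) :
    ∃ S₁ S₂ : Set (Ideal A), S₁.Nonempty ∧ S₂.Nonempty ∧ Disjoint S₁ S₂ ∧
      S₁ ∪ S₂ = minimalPrimes A ∧ sInf S₁ ⊔ sInf S₂ = maximalIdeal A := by
  have hsub₁ : {P | P ∈ minimalPrimes A ∧ maximalIdeal A ≠ P ⊔ P₁} ⊆ minimalPrimes A :=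
    fun P hP => hP.1
  have hsub₂ : {P | P ∈ minimalPrimes A ∧ maximalIdeal A = P ⊔ P₁} ⊆ minimalPrimes A :=
    fun P hP => hP.1
  have hne₁ : P₁ ∈ {P | P ∈ minimalPrimes A ∧ maximalIdeal A ≠ P ⊔ P₁} :=
    ⟨h₁, by rw [sup_idem]; exact (lt_maximalIdeal_of_mem_minimalPrimes hrank h₁).ne'⟩
  have hne₂ : P₂ ∈ {P | P ∈ minimalPrimes A ∧ maximalIdeal A = P ⊔ P₁} :=
    ⟨h₂, by rw [hsum, sup_comm]⟩
  refine ⟨_, _, ⟨P₁, hne₁⟩, ⟨P₂, hne₂⟩, ?_, ?_, hA.sInf_sup_sInf_eq_maximalIdeal hsub₁ hsub₂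
    (hfin.subset hsub₁) (hfin.subset hsub₂) ⟨P₁, hne₁⟩ ⟨P₂, hne₂⟩ ?_⟩
  · exact Set.disjoint_left.2 fun P hP hP' => hP.2 hP'.2
  · ext P
    simp only [Set.mem_union, Set.mem_ofPred_eq, ← and_or_left, ne_eq, not_or_of_imp id, and_true]
  · intro P hP Q hQ
    exact (hA.sup_eq_or_sup_eq (Ideal.IsMinimalPrime.isPrime hP.1)
      (Ideal.IsMinimalPrime.isPrime hQ.1) (Ideal.IsMinimalPrime.isPrime h₁) hQ.2).resolve_right hP.2

theorem isLocalRing_quotient {I : Ideal A} (hI : I ≠ ⊤) : IsLocalRing (A ⧸ I) := by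
  have := Ideal.Quotient.nontrivial_iff.2 hI
  exact IsLocalRing.of_surjective' (Ideal.Quotient.mk I) Ideal.Quotient.mk_surjective

theorem exists_residueField_ringEquiv {B : Type u} [CommRing B] [IsLocalRing B] {f : A →+* B}
    (hf : Function.Surjective f) : ∃ e : ResidueField B ≃+* ResidueField A,
      (e.toRingHom.comp (residue B)).comp f = residue A := by
  have : IsLocalHom f := hf.isLocalHom
  have hbij : Function.Bijective (ResidueField.map f) := by
    refine ⟨RingHom.injective _, fun y => ?_⟩
    obtain ⟨b, rfl⟩ := residue_surjective y
    obtain ⟨a, rfl⟩ := hf b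
    exact ⟨residue A a, ResidueField.map_residue f a⟩
  refine ⟨(RingEquiv.ofBijective (ResidueField.map f) hbij).symm, ?_⟩
  ext a
  exact (RingEquiv.symm_apply_eq (RingEquiv.ofBijective (ResidueField.map f) hbij)).2
    (ResidueField.map_residue f a).symm

/-- Quotients of a local real closed ring by the two intersections in a partition of the minimal
primes, glued along the residue field. -/
theorem IsRealClosedRing.exists_fibreProduct (hA : IsRealClosedRing A) {n : ℕ}
    (hn : (minimalPrimes A).encard = n) {S₁ S₂ : Set (Ideal A)} (hne₁ : S₁.Nonempty)
    (hne₂ : S₂.Nonempty) (hdisj : Disjoint S₁ S₂) (hunion : S₁ ∪ S₂ = minimalPrimes A)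
    (hsup : sInf S₁ ⊔ sInf S₂ = maximalIdeal A) :
    ∃ r ∈ Finset.Icc 1 n, ∃ s ∈ Finset.Icc 1 n, r + s = n ∧
      ∃ (A₁ A₂ K : Type u) (_ : CommRing A₁) (_ : CommRing A₂) (_ : Field K)
        (_ : IsLocalRing A₁) (_ : IsLocalRing A₂)
        (e₁ : ResidueField A₁ ≃+* K) (e₂ : ResidueField A₂ ≃+* K),
        IsRealClosedRing A₁ ∧ IsRealClosedRing A₂ ∧ ringRank A₁ = r ∧ ringRank A₂ = s ∧
        Nonempty (A ≃+* fibreProduct (e₁.toRingHom.comp (residue A₁))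
          (e₂.toRingHom.comp (residue A₂))) := by
  have hsub₁ : S₁ ⊆ minimalPrimes A := hunion ▸ Set.subset_union_left
  have hsub₂ : S₂ ⊆ minimalPrimes A := hunion ▸ Set.subset_union_right
  have hfin : (minimalPrimes A).Finite := Set.finite_of_encard_eq_coe hn
  have hfin₁ := hfin.subset hsub₁
  have hfin₂ := hfin.subset hsub₂
  have hadd : S₁.ncard + S₂.ncard = n := by
    rw [← Set.ncard_union_eq hdisj hfin₁ hfin₂, hunion, Set.ncard, hn, ENat.toNat_natCast]
  have hpos₁ := (Set.ncard_pos hfin₁).2 hne₁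
  have hpos₂ := (Set.ncard_pos hfin₂).2 hne₂
  have htop : sInf S₁ ⊔ sInf S₂ ≠ ⊤ := hsup ▸ (maximalIdeal.isMaximal A).ne_top
  have hred (S : Set (Ideal A)) (hS : S ⊆ minimalPrimes A) : IsReduced (A ⧸ sInf S) :=
    (Ideal.isRadical_iff_quotient_reduced _).1 (isRadical_sInf hS)
  have := hred S₁ hsub₁
  have := hred S₂ hsub₂
  have := isLocalRing_quotient (ne_top_of_le_ne_top htop le_sup_left)
  have := isLocalRing_quotient (ne_top_of_le_ne_top htop le_sup_right)
  obtain ⟨e₁, he₁⟩ := exists_residueField_ringEquiv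
    (Ideal.Quotient.mk_surjective (I := sInf S₁))
  obtain ⟨e₂, he₂⟩ := exists_residueField_ringEquiv
    (Ideal.Quotient.mk_surjective (I := sInf S₂))
  refine ⟨S₁.ncard, Finset.mem_Icc.2 ⟨hpos₁, by omega⟩, S₂.ncard,
    Finset.mem_Icc.2 ⟨hpos₂, by omega⟩, hadd, A ⧸ sInf S₁, A ⧸ sInf S₂, ResidueField A,
    inferInstance, inferInstance, inferInstance, inferInstance, inferInstance, e₁, e₂,
    hA.of_surjective Ideal.Quotient.mk_surjective, hA.of_surjective Ideal.Quotient.mk_surjective,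
    ?_, ?_, nonempty_ringEquiv_fibreProduct Ideal.Quotient.mk_surjective
      Ideal.Quotient.mk_surjective (he₁.trans he₂.symm) ?_ ?_⟩
  · rw [ringRank_quotient_sInf hfin₁ hsub₁, hfin₁.cast_ncard_eq]
  · rw [ringRank_quotient_sInf hfin₂ hsub₂, hfin₂.cast_ncard_eq]
  · have := hA.reduced
    rw [Ideal.mk_ker, Ideal.mk_ker, ← sInf_union, hunion, minimalPrimes, Ideal.sInf_minimalPrimes,
      Ideal.isRadical_bot.radical]
  · rw [he₁, ker_residue, Ideal.mk_ker, Ideal.mk_ker, hsup]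

theorem IsRealClosedRing.exists_minimalPrimes_of_isZeroDivisor (hA : IsRealClosedRing A)
    (hfin : (minimalPrimes A).Finite) (hrank : 2 ≤ (minimalPrimes A).encard)
    (h : ∀ a : A, ¬ IsUnit a → ∃ b c : A, IsZeroDivisor b ∧ IsZeroDivisor c ∧ a = b + c) :
    ∃ P₁ ∈ minimalPrimes A, ∃ P₂ ∈ minimalPrimes A, P₁ ≠ P₂ ∧ maximalIdeal A = P₁ ⊔ P₂ := by
  have := hA.reduced
  have hfin' := hfin.prod hfin
  have hprime (p : Ideal A × Ideal A) (hp : p ∈ hfin'.toFinset) : (p.1 ⊔ p.2).IsPrime := by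
    rw [Set.Finite.mem_toFinset] at hp
    exact hA.isPrime_sup (Ideal.IsMinimalPrime.isPrime hp.1) (Ideal.IsMinimalPrime.isPrime hp.2)
  have hcover : (maximalIdeal A : Set A) ⊆
      ⋃ p ∈ (hfin'.toFinset : Set (Ideal A × Ideal A)), (p.1 ⊔ p.2 : Ideal A) := by
    intro a ha
    obtain ⟨b, c, hb, hc, rfl⟩ := h a ((mem_maximalIdeal a).1 ha)
    obtain ⟨P, hP, hbP⟩ := hb.exists_mem_minimalPrimes
    obtain ⟨Q, hQ, hcQ⟩ := hc.exists_mem_minimalPrimes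
    rw [hfin'.coe_toFinset]
    exact Set.mem_iUnion₂.2 ⟨(P, Q), ⟨hP, hQ⟩, Submodule.add_mem_sup hbP hcQ⟩
  -- Prime avoidance permits two exceptional indices; all the ideals here are prime, so the pairs
  -- `(⊥, ⊥)` are placeholders.
  obtain ⟨⟨P, Q⟩, hPQ, hle⟩ := (Ideal.subset_union_prime
    (f := fun p : Ideal A × Ideal A => p.1 ⊔ p.2) ((⊥ : Ideal A), (⊥ : Ideal A))
    ((⊥ : Ideal A), (⊥ : Ideal A)) (fun p hp _ _ => hprime p hp)).1 hcover
  have heq := le_antisymm hle (le_maximalIdeal (hprime _ hPQ).ne_top)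
  rw [Set.Finite.mem_toFinset] at hPQ
  refine ⟨P, hPQ.1, Q, hPQ.2, ?_, heq⟩
  rintro rfl
  exact (lt_maximalIdeal_of_mem_minimalPrimes hrank hPQ.1).ne' (heq.trans (sup_idem P))

end Local

end BranchingIdeals
theorem propositionP (A : Type u) [CommRing A] [IsLocalRing A]
    (hA : BranchingIdeals.IsRealClosedRing A) (n : ℕ) (hn : 2 ≤ n)
    (hrank : BranchingIdeals.ringRank A = n) :
    List.TFAE [
      -- (i) the maximal ideal is a branching ideal
      BranchingIdeals.IsBranching (IsLocalRing.maximalIdeal A),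
      -- (ii) it is the sum of two distinct non-maximal primes, the first one arbitrary
      ∀ Q₁ : Ideal A, Q₁.IsPrime → Q₁ ≠ IsLocalRing.maximalIdeal A →
        ∃ Q₂ : Ideal A, Q₂.IsPrime ∧ Q₂ ≠ Q₁ ∧ Q₁ < IsLocalRing.maximalIdeal A ∧
          Q₂ < IsLocalRing.maximalIdeal A ∧ IsLocalRing.maximalIdeal A = Q₁ ⊔ Q₂,
      -- (iii) it is the sum of some two distinct minimal primes
      ∃ P₁ ∈ minimalPrimes A, ∃ P₂ ∈ minimalPrimes A, P₁ ≠ P₂ ∧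
        IsLocalRing.maximalIdeal A = P₁ ⊔ P₂,
      -- (iv) it is the sum of two distinct minimal primes, the first one arbitrary
      ∀ P₁ ∈ minimalPrimes A, ∃ P₂ ∈ minimalPrimes A, P₂ ≠ P₁ ∧
        IsLocalRing.maximalIdeal A = P₁ ⊔ P₂,
      -- (v) every non-unit is a sum of two zero divisors
      ∀ a : A, ¬ IsUnit a → ∃ b c : A, BranchingIdeals.IsZeroDivisor b ∧
        BranchingIdeals.IsZeroDivisor c ∧ a = b + c,
      -- (vi) a partition of the minimal primes into two sets whose intersections sum to it
      ∃ S₁ S₂ : Set (Ideal A), S₁.Nonempty ∧ S₂.Nonempty ∧ Disjoint S₁ S₂ ∧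
        S₁ ∪ S₂ = minimalPrimes A ∧ sInf S₁ ⊔ sInf S₂ = IsLocalRing.maximalIdeal A,
      -- (vii) a decomposition as a fibre product over the common residue field
      ∃ r ∈ Finset.Icc 1 n, ∃ s ∈ Finset.Icc 1 n, r + s = n ∧
        ∃ (A₁ A₂ K : Type u) (_ : CommRing A₁) (_ : CommRing A₂) (_ : Field K)
          (_ : IsLocalRing A₁) (_ : IsLocalRing A₂)
          (e₁ : IsLocalRing.ResidueField A₁ ≃+* K) (e₂ : IsLocalRing.ResidueField A₂ ≃+* K),
          BranchingIdeals.IsRealClosedRing A₁ ∧ BranchingIdeals.IsRealClosedRing A₂ ∧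
          BranchingIdeals.ringRank A₁ = r ∧ BranchingIdeals.ringRank A₂ = s ∧
          Nonempty (A ≃+* BranchingIdeals.fibreProduct
            (e₁.toRingHom.comp (IsLocalRing.residue A₁))
            (e₂.toRingHom.comp (IsLocalRing.residue A₂)))
    ] := by
  rw [BranchingIdeals.ringRank_eq_encard_minimalPrimes] at hrank
  have hfin : (minimalPrimes A).Finite := Set.finite_of_encard_eq_coe hrank
  have hrank2 : 2 ≤ (minimalPrimes A).encard := by
    rw [hrank]
    exact_mod_cast hn
  obtain ⟨P₀, hP₀⟩ : (minimalPrimes A).Nonempty :=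
    Set.nonempty_coe_sort.1 (Ideal.nonempty_minimalPrimes bot_ne_top)
  have hlt {P : Ideal A} (hP : P ∈ minimalPrimes A) : P < IsLocalRing.maximalIdeal A :=
    BranchingIdeals.lt_maximalIdeal_of_mem_minimalPrimes hrank2 hP
  have hprime {P : Ideal A} (hP : P ∈ minimalPrimes A) : P.IsPrime :=
    Ideal.IsMinimalPrime.isPrime hP
  -- Statement 3 is the hub: exchange links it to 1, 2 and 4, and the cycle 3 → 6 → 7 → 5 → 3 covers
  -- the rest.
  tfae_have 1 → 3 := hA.exists_minimalPrimes_of_isBranching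
  tfae_have 3 → 2 := by
    rintro ⟨P₁, h₁, P₂, h₂, -, hsum⟩ Q hQ hQm
    have hQlt : Q < IsLocalRing.maximalIdeal A :=
      lt_of_le_of_ne (IsLocalRing.le_maximalIdeal hQ.ne_top) hQm
    rcases hA.sup_eq_or_sup_eq hQ (hprime h₁) (hprime h₂) hsum with h | h
    · refine ⟨P₁, hprime h₁, ?_, hQlt, hlt h₁, h⟩
      rintro rfl
      exact hQm (h.trans (sup_idem _)).symm
    · refine ⟨P₂, hprime h₂, ?_, hQlt, hlt h₂, h⟩
      rintro rfl
      exact hQm (h.trans (sup_idem _)).symm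
  tfae_have 2 → 1 := by
    intro h
    obtain ⟨Q, hQ, hne, hlt₁, hlt₂, hsum⟩ := h P₀ (hprime hP₀) (hlt hP₀).ne
    exact ⟨inferInstance, P₀, Q, hprime hP₀, hQ, hne.symm, hlt₁, hlt₂, hsum⟩
  tfae_have 3 → 4 := by
    rintro ⟨P₁, h₁, P₂, h₂, -, hsum⟩ P hP
    rcases hA.sup_eq_or_sup_eq (hprime hP) (hprime h₁) (hprime h₂) hsum with h | h
    · refine ⟨P₁, h₁, ?_, h⟩
      rintro rfl
      exact (hlt hP).ne (h.trans (sup_idem _)).symm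
    · refine ⟨P₂, h₂, ?_, h⟩
      rintro rfl
      exact (hlt hP).ne (h.trans (sup_idem _)).symm
  tfae_have 4 → 3 := by
    intro h
    obtain ⟨P, hP, hne, hsum⟩ := h P₀ hP₀
    exact ⟨P₀, hP₀, P, hP, hne.symm, hsum⟩
  tfae_have 3 → 6 := by
    rintro ⟨P₁, h₁, P₂, h₂, -, hsum⟩
    exact hA.exists_partition hfin hrank2 h₁ h₂ hsum
  tfae_have 6 → 7 := by
    rintro ⟨S₁, S₂, hne₁, hne₂, hdisj, hunion, hsup⟩
    exact hA.exists_fibreProduct hrank hne₁ hne₂ hdisj hunion hsup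
  tfae_have 7 → 5 := by
    rintro ⟨r, hr, s, hs, hrs, A₁, A₂, K, _, _, _, _, _, e₁, e₂, -, -, hr₁, hr₂, ⟨e⟩⟩
    exact BranchingIdeals.exists_isZeroDivisor_add_of_fibreProduct hrank (Finset.mem_Icc.1 hr).1
      (Finset.mem_Icc.1 hs).1 hrs e₁ e₂ hr₁ hr₂ e
  tfae_have 5 → 3 := hA.exists_minimalPrimes_of_isZeroDivisor hfin hrank2
  tfae_finish
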